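/- All graphs are finite and simple. A \emph{graph property} is a class of finite graphs closed under isomorphism; it is \emph{hereditary} if it is closed under taking induced subgraphs. An \emph{ordering model} on a graph property $\mathcal P$ assigns to each $G\in\mathcal P$ a probability distribution $\mathbb P_G$ on the set of total orderings of $V(G)$. It is \emph{consistent} if, whenever $G,H\in\mathcal P$ and $\phi$ is an isomorphism from $H$ onto an induced subgraph of $G$, the random ordering $\mathbb P_H$ has the same distribution as the ordering of $V(H)$ induced via $\phi$ by $\mathbb P_G$; that is, $\mathbb P_H(x_1<\dots<x_k)=\mathbb P_G(\phi(x_1)<\dots<\phi(x_k))$ for all $x_1,\dots,x_k\in V(H)$. The property $\mathcal P$ is \emph{uniform} if the only consistent ordering model on $\mathcal P$ is the one in which, for every $G\in\mathcal P$, all $|V(G)|!$ orderings of $V(G)$ are equally likely. A \emph{forest} is a graph without cycles, it is \emph{non-empty} if it has at least one edge, and a \emph{leaf} is a vertex of degree $1$. Replacing a vertex by $n$ non-adjacent twins means replacing it by $n$ pairwise non-adjacent copies, each with the same neighbours as the original vertex. \textbf{Theorem.} Let $\mathcal P$ be a hereditary property of forests. Suppose that for every non-empty forest $F\in\mathcal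 P$ at least one of the following holds. (i) There exists a leaf $u$ of $F$ such that every graph obtained from $F$ by replacing $u$ by an arbitrary number of non-adjacent twins and then adding an arbitrary number of isolated vertices lies in $\mathcal P$. (ii) There exist two leaves $u_1,u_2$ of $F$, adjacent to distinct vertices $v_1,v_2\in V(F)$ respectively, such that every graph obtained from $F$ by replacing $u_1$ and $u_2$ by arbitrary (not necessarily equal) numbers of non-adjacent twins lies in $\mathcal P$. Then $\mathcal P$ is uniform. -/

import Mathlib

universe u

/-- A graph property: a collection of finite graphs (the vertex sets are arbitrary finite types)
closed under isomorphism. -/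
structure GraphProperty where
  /-- `Mem G` says that the finite graph `G` has the property. -/
  Mem : ∀ {V : Type u} [Finite V], SimpleGraph V → Prop
  mem_of_iso : ∀ {V W : Type u} [Finite V] [Finite W] {G : SimpleGraph V} {H : SimpleGraph W},
    Nonempty (G ≃g H) → Mem G → Mem H

/-- A graph property is hereditary if it is closed under taking induced subgraphs. -/
def GraphProperty.IsHereditary (P : GraphProperty.{u}) : Prop :=
  ∀ {V : Type u} [Finite V] (G : SimpleGraph V), P.Mem G → ∀ S : Set V, P.Mem (G.induce S)

/-- The (strict) total orderings of a vertex set `V`. -/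
def VertexOrder (V : Type u) : Type u :=
  {r : V → V → Prop // IsStrictTotalOrder V r}

/-- The ordering of `W` induced by an ordering of `V` along an injection `f : W → V`:
`x < y` in `W` if and only if `f x < f y` in `V`. -/
def VertexOrder.induced {V W : Type u} (f : W ↪ V) (r : VertexOrder V) : VertexOrder W :=
  ⟨fun x y => r.1 (f x) (f y),
    haveI := r.2
    (RelEmbedding.preimage f r.1).isStrictTotalOrder⟩

instance VertexOrder.instFinite (V : Type u) [Finite V] : Finite (VertexOrder V) :=
  inferInstanceAs (Finite {r : V → V → Prop // IsStrictTotalOrder V r})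

noncomputable instance VertexOrder.instFintype (V : Type u) [Finite V] :
    Fintype (VertexOrder V) :=
  Fintype.ofFinite _

instance VertexOrder.instNonempty (V : Type u) : Nonempty (VertexOrder V) :=
  ⟨⟨WellOrderingRel, inferInstance⟩⟩

/-- An ordering model on `P`: to each finite graph `G` in `P` it assigns a probability
distribution on the set of total orderings of the vertex set of `G`. -/
def OrderingModel (P : GraphProperty.{u}) : Type (u + 1) :=
  ∀ (V : Type u) [Finite V] (G : SimpleGraph V), P.Mem G → PMF (VertexOrder V)

/-- An ordering model is consistent if, whenever `H` and `G` belong to `P` and `φ` is an isomorphism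
from `H` to an induced subgraph of `G`, the random order of `H` has the same distribution as the
order induced through `φ` by the random order of `G`. -/
def OrderingModel.IsConsistent {P : GraphProperty.{u}} (μ : OrderingModel P) : Prop :=
  ∀ {V W : Type u} [Finite V] [Finite W] (G : SimpleGraph V) (H : SimpleGraph W)
    (hG : P.Mem G) (hH : P.Mem H) (φ : H ↪g G),
    (μ V G hG).map (VertexOrder.induced φ.toEmbedding) = μ W H hH

/-- The uniform ordering model: all orderings of the vertex set of `G` are equally likely. -/
noncomputable def OrderingModel.uniform (P : GraphProperty.{u}) : OrderingModel P :=
  fun V _ _ _ => PMF.uniformOfFintype (VertexOrder V)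

/-- A property is uniform if the uniform ordering model is the one and only consistent ordering
model on it. -/
def GraphProperty.IsUniform (P : GraphProperty.{u}) : Prop :=
  ∀ μ : OrderingModel P, μ.IsConsistent ↔ μ = OrderingModel.uniform P

/-- A leaf is a vertex of degree one. -/
def SimpleGraph.IsLeafVertex {V : Type u} (G : SimpleGraph V) (v : V) : Prop :=
  (G.neighborSet v).ncard = 1

/-- The graph obtained from `G` by replacing every vertex `v` by `m v` pairwise non-adjacent twins:
copies of `v` and `w` are adjacent if and only if `v` and `w` are adjacent in `G`. Vertices `v` with
`m v = 1` are unaffected. -/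
def SimpleGraph.blowUp {V : Type u} (G : SimpleGraph V) (m : V → ℕ) :
    SimpleGraph (Σ v : V, Fin (m v)) :=
  G.comap Sigma.fst

/-- There is a leaf `u` of `F` such that every graph obtained from `F` by replacing `u` by
any number of non-adjacent twins, and then adding any number `k` of isolated vertices, lies in `P`. -/
def GraphProperty.HasFreeLeaf (P : GraphProperty.{u}) {V : Type u} [Finite V]
    (F : SimpleGraph V) : Prop :=
  ∃ u : V, F.IsLeafVertex u ∧
    ∀ m : V → ℕ, (∀ v, v ≠ u → m v = 1) →
      ∀ k : ℕ, P.Mem (F.blowUp m ⊕g (⊥ : SimpleGraph (Fin k)))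

/-- There are two leaves `u₁`, `u₂` of `F`, with distinct neighbours `v₁`, `v₂`, such that every
graph obtained from `F` by replacing `u₁` and `u₂` by any numbers of non-adjacent twins lies
in `P`. -/
def GraphProperty.HasFreeLeafPair (P : GraphProperty.{u}) {V : Type u} [Finite V]
    (F : SimpleGraph V) : Prop :=
  ∃ u₁ u₂ v₁ v₂ : V, F.IsLeafVertex u₁ ∧ F.IsLeafVertex u₂ ∧ F.Adj u₁ v₁ ∧ F.Adj u₂ v₂ ∧
    v₁ ≠ v₂ ∧
    ∀ m : V → ℕ, (∀ v, v ≠ u₁ → v ≠ u₂ → m v = 1) → P.Mem (F.blowUp m)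

/-! On an edgeless graph consistency makes the ordering invariant under all permutations, hence
uniform. Otherwise a hypothesis supplies a leaf that can be moved without changing the random
ordering: in case (i) the leaf becomes isolated, in case (ii) one leaf becomes a twin of the other.
Each move lowers the potential `∑ d(v) (2|V| - d(v))`, provided that in case (ii) the leaf moves
towards the neighbour of larger or equal degree. Induction on the potential finishes.

That a move preserves the distribution is `OrderingModel.IsConsistent.eq_of_embeddings`. Blowing up
yields one graph `X` containing `n` copies of `F` and `n` copies of the modified graph `F'` that
share all vertices except the moved one, whose `2n` images form an independent set. Given the order
of `X`, a copy induces a fixed order `τ` exactly when its private vertex lies in an interval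
determined by the shared vertices. The `2n` private vertices are uniformly ordered among themselves,
so with high probability every initial segment contains nearly as many from one family as from the
other, up to `o(n)`. This is uniform over segments, so the dependence on the shared vertices is
harmless. Averaging shows that the probabilities of `τ` under `F` and `F'` differ by `o(1)`, hence
agree. -/

namespace VertexOrder

/-! ### Orderings and their uniform distribution -/

theorem induced_apply {V W : Type u} (f : W ↪ V) (r : VertexOrder V) (x y : W) :
    (r.induced f).1 x y ↔ r.1 (f x) (f y) := Iff.rfl

theorem ext_iff' {V : Type u} {r s : VertexOrder V} : r = s ↔ ∀ x y, r.1 x y ↔ s.1 x y := by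
  refine ⟨by rintro rfl _ _; rfl, fun h => Subtype.ext ?_⟩
  funext x y
  exact propext (h x y)

theorem irrefl {V : Type u} (r : VertexOrder V) (x : V) : ¬ r.1 x x :=
  haveI := r.2; irrefl_of r.1 x

theorem trans {V : Type u} (r : VertexOrder V) {x y z : V} (h : r.1 x y) (h' : r.1 y z) :
    r.1 x z :=
  haveI := r.2; trans_of r.1 h h'

theorem trichotomous {V : Type u} (r : VertexOrder V) (x y : V) :
    r.1 x y ∨ x = y ∨ r.1 y x :=
  haveI := r.2; trichotomous_of r.1 x y

/-- The linear order on `V` given by a vertex order. -/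
noncomputable abbrev toLinearOrder {V : Type u} (r : VertexOrder V) : LinearOrder V :=
  haveI := r.2
  haveI := Classical.decRel r.1
  linearOrderOfSTO r.1

theorem lt_iff {V : Type u} (r : VertexOrder V) (x y : V) :
    (letI := r.toLinearOrder; x < y) ↔ r.1 x y := Iff.rfl

/-- Permutations act transitively on the orderings of a finite set. -/
theorem exists_perm_induced_eq {V : Type u} [Finite V] (r s : VertexOrder V) :
    ∃ e : Equiv.Perm V, r.induced e.toEmbedding = s := by
  classical
  have := Fintype.ofFinite V
  let e₁ := @Fintype.orderIsoFinOfCardEq V r.toLinearOrder _ _ rfl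
  let e₂ := @Fintype.orderIsoFinOfCardEq V s.toLinearOrder _ _ rfl
  refine ⟨e₂.toEquiv.symm.trans e₁.toEquiv, ext_iff'.2 fun x y => ?_⟩
  rw [induced_apply, ← r.lt_iff, ← s.lt_iff]
  let := s.toLinearOrder
  have h₂ := @OrderIso.lt_iff_lt V (Fin _) s.toLinearOrder.toPreorder _ e₂.symm x y
  have h₁ := @OrderIso.lt_iff_lt (Fin _) V _ r.toLinearOrder.toPreorder e₁ (e₂.symm x) (e₂.symm y)
  exact h₁.trans h₂

/-- A distribution of orderings invariant under all permutations is uniform. -/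
theorem eq_uniform_of_perm_invariant {V : Type u} [Finite V] (q : PMF (VertexOrder V))
    (h : ∀ e : Equiv.Perm V, q.map (VertexOrder.induced e.toEmbedding) = q) :
    q = PMF.uniformOfFintype (VertexOrder V) := by
  classical
  have hinj : ∀ e : Equiv.Perm V,
      Function.Injective (VertexOrder.induced (V := V) e.toEmbedding) := by
    intro e r s hrs
    refine ext_iff'.2 fun x y => ?_
    have := ext_iff'.1 hrs (e.symm x) (e.symm y)
    simpa [induced_apply] using this
  have hconst : ∀ r s, q r = q s := by
    intro r s
    -- Invariance moves the mass at `r` to its image; injectivity ensures that no other ordering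
    -- contributes there.
    obtain ⟨e, rfl⟩ := exists_perm_induced_eq r s
    conv_rhs => rw [← h e]
    rw [PMF.map_apply, tsum_eq_single r]
    · simp
    · intro s hs
      rw [if_neg]
      exact fun hh => hs (hinj e hh).symm
  ext r
  have hsum : ∑ s, q s = 1 := by rw [← tsum_fintype (L := .unconditional _)]; exact q.tsum_coe
  rw [Finset.sum_congr rfl fun s _ => hconst s r, Finset.sum_const, Finset.card_univ,
    nsmul_eq_mul] at hsum
  rw [PMF.uniformOfFintype_apply]
  exact ENNReal.eq_inv_of_mul_eq_one_left (by rw [mul_comm]; exact hsum)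

theorem uniform_map_perm {V : Type u} [Finite V] (e : Equiv.Perm V) :
    (PMF.uniformOfFintype (VertexOrder V)).map (VertexOrder.induced e.toEmbedding) =
      PMF.uniformOfFintype (VertexOrder V) := by
  classical
  ext s
  have key : ∀ r : VertexOrder V,
      s = r.induced e.toEmbedding ↔ r = s.induced e.symm.toEmbedding := by
    intro r
    constructor
    · rintro rfl
      exact ext_iff'.2 fun x y => by simp [induced_apply]
    · rintro rfl
      exact ext_iff'.2 fun x y => by simp [induced_apply]
  rw [PMF.map_apply, tsum_eq_single (s.induced e.symm.toEmbedding)]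
  · rw [if_pos ((key _).2 rfl)]
    simp
  · intro r hr
    rw [if_neg fun hh => hr ((key r).1 hh)]

/-- Every permutation of `W` extends along `f` to one of `V`, which preserves the uniform
distribution, so the pushforward is permutation-invariant. -/
theorem uniform_map_induced {V W : Type u} [Finite V] [Finite W] (f : W ↪ V) :
    (PMF.uniformOfFintype (VertexOrder V)).map (VertexOrder.induced f) =
      PMF.uniformOfFintype (VertexOrder W) := by
  refine eq_uniform_of_perm_invariant _ fun e => ?_
  rw [PMF.map_comp]
  conv_rhs => rw [← uniform_map_perm (e.viaEmbedding f), PMF.map_comp]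
  congr 1
  funext r
  refine ext_iff'.2 fun x y => ?_
  simp [induced_apply, Equiv.Perm.viaEmbedding_apply]

end VertexOrder

theorem OrderingModel.uniform_isConsistent (P : GraphProperty.{u}) :
    (OrderingModel.uniform P).IsConsistent :=
  fun _ _ _ _ φ => VertexOrder.uniform_map_induced φ.toEmbedding

/-- Every permutation is an automorphism of the edgeless graph. This is both the base of the
induction and the source of randomness on independent sets. -/
theorem OrderingModel.IsConsistent.eq_uniform_of_bot {P : GraphProperty.{u}} {μ : OrderingModel P}
    (hμ : μ.IsConsistent) {V : Type u} [Finite V] (h : P.Mem (⊥ : SimpleGraph V)) :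
    μ V ⊥ h = PMF.uniformOfFintype (VertexOrder V) :=
  VertexOrder.eq_uniform_of_perm_invariant _ fun e =>
    hμ ⊥ ⊥ h h (⟨e.toEmbedding, by simp⟩ : (⊥ : SimpleGraph V) ↪g (⊥ : SimpleGraph V))

/-! ### Expectations and moments under sign flips -/

namespace PMF

variable {α β : Type*} [Fintype α] [Fintype β]

/-- The expectation of a real function under a distribution on a finite type. -/
noncomputable def expect (p : PMF α) (h : α → ℝ) : ℝ := ∑ a, (p a).toReal * h a

theorem sum_toReal (p : PMF α) : ∑ a, (p a).toReal = 1 := by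
  rw [← ENNReal.toReal_sum fun a _ => p.apply_ne_top a,
    ← tsum_fintype (L := .unconditional _), p.tsum_coe, ENNReal.toReal_one]

theorem expect_const (p : PMF α) (c : ℝ) : p.expect (fun _ => c) = c := by
  rw [expect, ← Finset.sum_mul, sum_toReal, one_mul]

theorem expect_add (p : PMF α) (f g : α → ℝ) :
    p.expect (fun a => f a + g a) = p.expect f + p.expect g := by
  simp only [expect, mul_add, Finset.sum_add_distrib]

theorem expect_mul_left (p : PMF α) (c : ℝ) (f : α → ℝ) :
    p.expect (fun a => c * f a) = c * p.expect f := by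
  simp only [expect, Finset.mul_sum]
  exact Finset.sum_congr rfl fun a _ => by ring

theorem expect_neg (p : PMF α) (f : α → ℝ) :
    p.expect (fun a => - f a) = - p.expect f := by
  simp [expect]

theorem expect_sub (p : PMF α) (f g : α → ℝ) :
    p.expect (fun a => f a - g a) = p.expect f - p.expect g := by
  simp only [expect, mul_sub, Finset.sum_sub_distrib]

theorem expect_sum {ι : Type*} (p : PMF α) (s : Finset ι) (f : ι → α → ℝ) :
    p.expect (fun a => ∑ i ∈ s, f i a) = ∑ i ∈ s, p.expect (f i) := by
  simp only [expect, Finset.mul_sum]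
  exact Finset.sum_comm

theorem expect_mono (p : PMF α) {f g : α → ℝ} (h : ∀ a, f a ≤ g a) :
    p.expect f ≤ p.expect g :=
  Finset.sum_le_sum fun a _ => mul_le_mul_of_nonneg_left (h a) ENNReal.toReal_nonneg

theorem expect_map (p : PMF α) (φ : α → β) (h : β → ℝ) :
    (p.map φ).expect h = p.expect (fun a => h (φ a)) := by
  classical
  simp only [expect, PMF.map_apply, tsum_fintype]
  have : ∀ b, (∑ a, if b = φ a then p a else 0).toReal =
      ∑ a, if b = φ a then (p a).toReal else 0 := by
    intro b
    rw [ENNReal.toReal_sum]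
    · exact Finset.sum_congr rfl fun a _ => by split_ifs <;> simp
    · intro a _
      split_ifs
      · exact p.apply_ne_top a
      · simp
  simp only [this, Finset.sum_mul]
  rw [Finset.sum_comm]
  exact Finset.sum_congr rfl fun a _ => by simp [ite_mul]

theorem expect_indicator [DecidableEq α] (p : PMF α) (b : α) :
    p.expect (fun a => if a = b then 1 else 0) = (p b).toReal := by
  simp [expect]

/-- Moment bounds for a sum of bounded variables whose signs can be flipped independently by
transformations that preserve the distribution. -/
theorem expect_sum_pow_le {ι : Type*} [DecidableEq ι] (p : PMF α) (X : ι → α → ℝ) (s : ι → α → α)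
    (I : Finset ι) (hs : ∀ i ∈ I, ∀ h : α → ℝ, p.expect (fun a => h (s i a)) = p.expect h)
    (hb : ∀ i a, |X i a| ≤ 1) (hflip : ∀ i ∈ I, ∀ a, X i (s i a) = - X i a)
    (hfix : ∀ i ∈ I, ∀ j, j ≠ i → ∀ a, X j (s i a) = X j a) :
    p.expect (fun a => (∑ i ∈ I, X i a) ^ 2) ≤ I.card ∧
      p.expect (fun a => (∑ i ∈ I, X i a) ^ 4) ≤ 3 * (I.card : ℝ) ^ 2 := by
  induction I using Finset.induction_on with
  | empty => simp [expect]
  | insert k I hk ih =>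
    obtain ⟨ih₂, ih₄⟩ := ih (fun i hi => hs i (Finset.mem_insert_of_mem hi))
      (fun i hi => hflip i (Finset.mem_insert_of_mem hi))
      (fun i hi => hfix i (Finset.mem_insert_of_mem hi))
    set S : α → ℝ := fun a => ∑ i ∈ I, X i a with hS
    have hSk : ∀ a, S (s k a) = S a := fun a => Finset.sum_congr rfl fun i hi =>
      hfix k (Finset.mem_insert_self _ _) i (fun h => hk (h ▸ hi)) a
    have hXk := hflip k (Finset.mem_insert_self _ _)
    -- The flip `s k` negates `X k` and fixes `S`, so terms of odd degree in `X k` have mean zero.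
    have odd : ∀ h : α → ℝ, (∀ a, h (s k a) = - h a) → p.expect h = 0 := by
      intro h hh
      have := hs k (Finset.mem_insert_self _ _) h
      simp only [hh, expect_neg] at this
      linarith
    have h₁ : p.expect (fun a => X k a * S a) = 0 := odd _ fun a => by rw [hSk, hXk]; ring
    have h₂ : p.expect (fun a => X k a * S a ^ 3) = 0 := odd _ fun a => by rw [hSk, hXk]; ring
    have h₃ : p.expect (fun a => X k a ^ 3 * S a) = 0 := odd _ fun a => by rw [hSk, hXk]; ring
    have hX2 : ∀ a, X k a ^ 2 ≤ 1 := fun a => (sq_le_one_iff_abs_le_one _).2 (hb k a)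
    simp only [Finset.sum_insert hk, Finset.card_insert_of_notMem hk]
    push_cast
    constructor
    · calc p.expect (fun a => (X k a + S a) ^ 2)
          ≤ p.expect (fun a => 1 + (2 * (X k a * S a) + S a ^ 2)) :=
            p.expect_mono fun a => by nlinarith [hX2 a]
        _ = 1 + (2 * 0 + p.expect (fun a => S a ^ 2)) := by
            rw [expect_add, expect_add, expect_const, expect_mul_left, h₁]
        _ ≤ _ := by linarith
    · calc p.expect (fun a => (X k a + S a) ^ 4)
          ≤ p.expect (fun a => 1 + (4 * (X k a ^ 3 * S a) + (4 * (X k a * S a ^ 3) +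
              (6 * S a ^ 2 + S a ^ 4)))) := by
            refine p.expect_mono fun a => ?_
            have h4 : X k a ^ 4 ≤ 1 := by nlinarith [hX2 a, sq_nonneg (X k a)]
            have h5 : X k a ^ 2 * S a ^ 2 ≤ 1 * S a ^ 2 :=
              mul_le_mul_of_nonneg_right (hX2 a) (sq_nonneg _)
            nlinarith
        _ = 1 + (4 * 0 + (4 * 0 + (6 * p.expect (fun a => S a ^ 2) +
              p.expect (fun a => S a ^ 4)))) := by
            simp only [expect_add, expect_const, expect_mul_left, h₂, h₃]
        _ ≤ _ := by nlinarith

end PMF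

/-! ### Discrepancy of initial segments -/

/-- The number of `i` with `u i ∈ Q`, minus the number of `i` with `r i ∈ Q`. -/
noncomputable def discrepancy {I Y : Type*} [Fintype I] (c : I ⊕ I → Y) (Q : Set Y) : ℝ :=
  ∑ i, (Q.indicator 1 (c (.inl i)) - Q.indicator 1 (c (.inr i)))

theorem discrepancy_congr {I Y Z : Type*} [Fintype I] {c : I ⊕ I → Y} {d : I ⊕ I → Z}
    {Q : Set Y} {R : Set Z} (h : ∀ t, c t ∈ Q ↔ d t ∈ R) :
    discrepancy c Q = discrepancy d R := by
  have key (t : I ⊕ I) : Q.indicator (1 : Y → ℝ) (c t) = R.indicator 1 (d t) := by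
    by_cases ht : c t ∈ Q
    · simp [ht, (h t).1 ht]
    · simp [ht, mt (h t).2 ht]
  simp only [discrepancy, key]

/-- The discrepancy of a lower set is controlled by the discrepancies of principal lower sets. -/
theorem discrepancy_pow_le {I Y : Type*} [Fintype I] [LinearOrder Y] (c : I ⊕ I → Y) {Q : Set Y}
    (hQ : IsLowerSet Q) :
    discrepancy c Q ^ 4 ≤ ∑ t, discrepancy c (Set.Iic (c t)) ^ 4 := by
  classical
  have nonneg : ∀ t ∈ Finset.univ, 0 ≤ discrepancy c (Set.Iic (c t)) ^ 4 :=
    fun t _ => by positivity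
  by_cases h : ∃ t, c t ∈ Q
  · obtain ⟨t, ht, hmax⟩ := Finset.exists_max_image (Finset.univ.filter fun t => c t ∈ Q) c
      (by obtain ⟨t, ht⟩ := h; exact ⟨t, by simpa using ht⟩)
    simp only [Finset.mem_filter, Finset.mem_univ, true_and] at ht hmax
    -- `Q` and the segment below its largest sample point contain the same sample points.
    rw [discrepancy_congr (c := c) (d := c) (R := Set.Iic (c t))
      fun s => ⟨fun hs => hmax s hs, fun hs => hQ hs ht⟩]
    exact Finset.single_le_sum nonneg (Finset.mem_univ t)
  · push Not at h
    have h0 : discrepancy c Q = 0 := by simp [discrepancy, h]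
    rw [h0, zero_pow (by norm_num)]
    exact Finset.sum_nonneg nonneg

namespace VertexOrder

/-- The lower set of elements at or below `t`. -/
def Iic {V : Type u} (r : VertexOrder V) (t : V) : Set V := {x | r.1 x t ∨ x = t}

open Classical in
/-- Suppose that two families of embeddings of `V` agree with `b` away from the vertex `x`. The
numbers of embeddings in the two families that induce a given ordering differ by a difference of
discrepancies of lower sets. -/
theorem exists_count_sub_eq {I V Y : Type u} [Fintype I] (ω : VertexOrder Y) (τ : VertexOrder V)
    (x : V) (b : V → Y) (f g : I → V ↪ Y) (hf : ∀ i w, w ≠ x → f i w = b w)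
    (hg : ∀ i w, w ≠ x → g i w = b w) :
    ∃ H L : Set Y, (∀ y z, ω.1 y z → z ∈ H → y ∈ H) ∧ (∀ y z, ω.1 y z → z ∈ L → y ∈ L) ∧
      ∑ i, ((if ω.induced (f i) = τ then 1 else 0) - (if ω.induced (g i) = τ then (1 : ℝ) else 0)) =
        discrepancy (Sum.elim (f · x) (g · x)) H - discrepancy (Sum.elim (f · x) (g · x)) L := by
  by_cases hc : ∀ v w, v ≠ x → w ≠ x → (τ.1 v w ↔ ω.1 (b v) (b w))
  · let H : Set Y := {y | ∀ w, τ.1 x w → ω.1 y (b w)}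
    let L : Set Y := {y | ∃ w, τ.1 w x ∧ (ω.1 y (b w) ∨ y = b w)}
    have ne_r : ∀ {w}, τ.1 x w → w ≠ x := fun h e => τ.irrefl x (e ▸ h)
    have ne_l : ∀ {w}, τ.1 w x → w ≠ x := fun h e => τ.irrefl x (e ▸ h)
    have hLH : L ⊆ H := by
      rintro y ⟨w, hw, hy⟩ w' hw'
      have := (hc w w' (ne_l hw) (ne_r hw')).1 (τ.trans hw hw')
      rcases hy with hy | rfl
      · exact ω.trans hy this
      · exact this
    have key : ∀ e : V ↪ Y, (∀ w, w ≠ x → e w = b w) →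
        (ω.induced e = τ ↔ e x ∈ H ∧ e x ∉ L) := by
      intro e he
      constructor
      · rintro rfl
        refine ⟨fun w hw => he w (ne_r hw) ▸ hw, ?_⟩
        rintro ⟨w, hw, hlt | heq⟩
        · rw [← he w (ne_l hw)] at hlt
          exact ω.irrefl _ (ω.trans hw hlt)
        · rw [← he w (ne_l hw)] at heq
          exact ne_l hw (e.injective heq).symm
      · rintro ⟨hH, hL⟩
        refine ext_iff'.2 fun v w => ?_
        rw [induced_apply]
        by_cases hv : v = x <;> by_cases hw : w = x
        · subst hv; subst hw
          exact iff_of_false (ω.irrefl _) (τ.irrefl _)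
        · subst hv
          rw [he w hw]
          refine ⟨fun h => ?_, fun h => hH w h⟩
          rcases τ.trichotomous v w with h' | h' | h'
          · exact h'
          · exact absurd h'.symm hw
          · exact absurd ⟨w, h', Or.inl h⟩ hL
        · subst hw
          rw [he v hv]
          refine ⟨fun h => ?_, fun h => ?_⟩
          · rcases τ.trichotomous v w with h' | h' | h'
            · exact h'
            · exact absurd h' hv
            · exact absurd (ω.trans h (hH v h')) (ω.irrefl _)
          · rcases ω.trichotomous (b v) (e w) with h' | h' | h'
            · exact h'
            · exact absurd ⟨v, h, Or.inr h'.symm⟩ hL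
            · exact absurd ⟨v, h, Or.inl h'⟩ hL
        · rw [he v hv, he w hw]
          exact (hc v w hv hw).symm
    have ind : ∀ e : V ↪ Y, (∀ w, w ≠ x → e w = b w) →
        (if ω.induced e = τ then (1 : ℝ) else 0) =
          H.indicator 1 (e x) - L.indicator 1 (e x) := by
      intro e he
      by_cases h₁ : e x ∈ L
      · simp [key e he, h₁, hLH h₁]
      · simp [key e he, h₁, Set.indicator_apply]
    refine ⟨H, L, fun y z hyz hz w hw => ω.trans hyz (hz w hw), ?_, ?_⟩
    · rintro y z hyz ⟨w, hw, hz⟩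
      refine ⟨w, hw, Or.inl ?_⟩
      rcases hz with hz | rfl
      · exact ω.trans hyz hz
      · exact hyz
    · rw [discrepancy, discrepancy, ← Finset.sum_sub_distrib]
      refine Finset.sum_congr rfl fun i _ => ?_
      rw [ind _ (hf i), ind _ (hg i)]
      simp only [Sum.elim_inl, Sum.elim_inr]
      ring
  -- Here `τ` already disagrees with `ω` away from `x`, so no embedding induces it.
  · refine ⟨∅, ∅, by simp, by simp, ?_⟩
    have : ∀ e : V ↪ Y, (∀ w, w ≠ x → e w = b w) → ω.induced e ≠ τ := by
      rintro e he rfl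
      refine hc fun v w hv hw => ?_
      rw [induced_apply, he v hv, he w hw]
    rw [sub_self]
    exact Finset.sum_eq_zero fun i _ => by
      rw [if_neg (this _ (hf i)), if_neg (this _ (hg i)), sub_zero]

/-- The fourth moment of the discrepancy of a principal lower set in a random ordering. -/
theorem expect_discrepancy_le {I : Type u} [Fintype I] (p : PMF (VertexOrder (I ⊕ I)))
    (hp : ∀ e : Equiv.Perm (I ⊕ I), p.map (VertexOrder.induced e.toEmbedding) = p) (t : I ⊕ I) :
    p.expect (fun ω => discrepancy id (ω.Iic t) ^ 4) ≤ 32 * (Fintype.card I : ℝ) ^ 2 := by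
  classical
  let X : I → VertexOrder (I ⊕ I) → ℝ := fun i ω =>
    (ω.Iic t).indicator 1 (.inl i) - (ω.Iic t).indicator 1 (.inr i)
  obtain ⟨k, hk⟩ : ∃ k : I, t = .inl k ∨ t = .inr k := by
    rcases t with k | k
    exacts [⟨k, .inl rfl⟩, ⟨k, .inr rfl⟩]
  have hb : ∀ i ω, |X i ω| ≤ 1 := by
    intro i ω
    simp only [X, Set.indicator_apply, Pi.one_apply]
    split_ifs <;> norm_num
  let s : I → VertexOrder (I ⊕ I) → VertexOrder (I ⊕ I) := fun i =>
    VertexOrder.induced (Equiv.swap (Sum.inl i) (Sum.inr i)).toEmbedding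
  have hmem : ∀ i, i ≠ k → ∀ ω a,
      a ∈ (s i ω).Iic t ↔ Equiv.swap (Sum.inl i) (Sum.inr i) a ∈ ω.Iic t := by
    intro i hi ω a
    have ht : Equiv.swap (Sum.inl i) (Sum.inr i) t = t := by
      apply Equiv.swap_apply_of_ne_of_ne <;> rcases hk with rfl | rfl <;> simp [Ne.symm hi]
    have h1 : a = t ↔ Equiv.swap (Sum.inl i) (Sum.inr i) a = t := by
      conv_rhs => rw [← ht]
      exact (Equiv.apply_eq_iff_eq _).symm
    simp only [Iic, Set.mem_ofPred_eq, s, induced_apply, Equiv.coe_toEmbedding, ht, ← h1]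
  -- Swapping the pair `k` containing `t` would move the threshold, so only the other pairs are
  -- flipped.
  have hS := (p.expect_sum_pow_le X s (Finset.univ.erase k)
    (fun i _ h => by rw [← p.expect_map, hp]) hb
    (fun i hi ω => by simp [X, Set.indicator_apply, hmem i (Finset.ne_of_mem_erase hi)])
    (fun i hi j hj ω => by
      have h1 : Equiv.swap (Sum.inl i) (Sum.inr i) (Sum.inl j : I ⊕ I) = Sum.inl j :=
        Equiv.swap_apply_of_ne_of_ne (by simpa using hj) (by simp)
      have h2 : Equiv.swap (Sum.inl i) (Sum.inr i) (Sum.inr j : I ⊕ I) = Sum.inr j :=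
        Equiv.swap_apply_of_ne_of_ne (by simp) (by simpa using hj)
      simp only [X, Set.indicator_apply, hmem i (Finset.ne_of_mem_erase hi), h1, h2, Pi.one_apply])).2
  have hcard : ((Finset.univ.erase k).card : ℝ) ^ 2 ≤ (Fintype.card I : ℝ) ^ 2 := by
    have : (Finset.univ.erase k).card ≤ Fintype.card I := Finset.card_le_univ _
    gcongr
  have hcard1 : (1 : ℝ) ≤ (Fintype.card I : ℝ) ^ 2 := by
    have : 1 ≤ Fintype.card I := Fintype.card_pos_iff.2 ⟨k⟩
    exact one_le_pow₀ (by exact_mod_cast this)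
  -- The pair `k` contributes at most 1 in absolute value; `(x + y)^4 ≤ 8 (x^4 + y^4)` then gives `8
  -- + 8 · 3n² ≤ 32n²`.
  calc p.expect (fun ω => discrepancy id (ω.Iic t) ^ 4)
      ≤ p.expect (fun ω => 8 + 8 * (∑ i ∈ Finset.univ.erase k, X i ω) ^ 4) := by
        refine p.expect_mono fun ω => ?_
        have : discrepancy id (ω.Iic t) = X k ω + ∑ i ∈ Finset.univ.erase k, X i ω := by
          exact (Finset.add_sum_erase _ (fun i => X i ω) (Finset.mem_univ k)).symm
        rw [this]
        generalize ∑ i ∈ Finset.univ.erase k, X i ω = y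
        have h2 : X k ω ^ 2 ≤ 1 := (sq_le_one_iff_abs_le_one _).2 (hb k ω)
        generalize X k ω = x at h2
        have h4 : x ^ 4 ≤ 1 := by nlinarith [sq_nonneg x]
        have h5 : (x + y) ^ 4 ≤ 8 * (x ^ 4 + y ^ 4) := by
          have h6 : (x + y) ^ 2 ≤ 2 * (x ^ 2 + y ^ 2) := by nlinarith [sq_nonneg (x - y)]
          calc (x + y) ^ 4 = ((x + y) ^ 2) ^ 2 := by ring
            _ ≤ (2 * (x ^ 2 + y ^ 2)) ^ 2 := by gcongr
            _ ≤ _ := by nlinarith [sq_nonneg (x ^ 2 - y ^ 2)]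
        linarith
    _ = 8 + 8 * p.expect (fun ω => (∑ i ∈ Finset.univ.erase k, X i ω) ^ 4) := by
        rw [PMF.expect_add, PMF.expect_const, PMF.expect_mul_left]
    _ ≤ _ := by linarith

end VertexOrder

/-! ### Comparing two graphs inside a common graph -/

/-- A pointwise form of Markov's inequality: it turns a fourth moment bound into a first moment
bound. -/
theorem abs_le_add_div_of_pow_le {x z l : ℝ} (hl : 0 < l) (h : x ^ 4 ≤ z) :
    |x| ≤ l + z / l ^ 3 := by
  have hz : 0 ≤ z := le_trans (by positivity) h
  rcases le_total |x| l with hx | hx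
  · have : 0 ≤ z / l ^ 3 := by positivity
    linarith
  · have : |x| ≤ z / l ^ 3 := by
      rw [le_div_iff₀ (by positivity)]
      calc |x| * l ^ 3 ≤ |x| * |x| ^ 3 := by gcongr
        _ = x ^ 4 := by rw [← pow_succ', Even.pow_abs (by decide)]
        _ ≤ z := h
    linarith

/-- Two graphs on the same vertex set have the same random ordering if, for every `n`, they embed
into a common graph in `n` ways each, such that all embeddings agree except at one vertex, and the
images of that vertex are distinct and independent. -/
theorem OrderingModel.IsConsistent.eq_of_embeddings {P : GraphProperty.{u}} {μ : OrderingModel P}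
    (hμ : μ.IsConsistent) (hP : P.IsHereditary) {V : Type u} [Finite V] {F F' : SimpleGraph V}
    (hF : P.Mem F) (hF' : P.Mem F') (x : V)
    (h : ∀ n : ℕ, 0 < n → ∃ (I Y : Type u) (_ : Fintype I) (_ : Finite Y) (X : SimpleGraph Y)
      (_ : P.Mem X) (b : V → Y)
      (f : I → F ↪g X) (g : I → F' ↪g X), Fintype.card I = n ∧
      (∀ i w, w ≠ x → f i w = b w) ∧ (∀ i w, w ≠ x → g i w = b w) ∧
      Function.Injective (Sum.elim (f · x) (g · x)) ∧
      ∀ s t, ¬ X.Adj (Sum.elim (f · x) (g · x) s) (Sum.elim (f · x) (g · x) t)) :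
    μ V F hF = μ V F' hF' := by
  classical
  ext τ
  rw [← ENNReal.toReal_eq_toReal_iff' (PMF.apply_ne_top _ _) (PMF.apply_ne_top _ _)]
  set d : ℝ := (μ V F hF τ).toReal - (μ V F' hF' τ).toReal with hd
  have bound : ∀ n : ℕ, 0 < n → ∀ ε : ℝ, 0 < ε → |d| ≤ 2 * (ε + 64 / (ε ^ 3 * n)) := by
    intro n hn ε hε
    obtain ⟨I, Y, _, _, X, hX, b, f, g, hI, hfb, hgb, hinj, hind⟩ := h n hn
    set c : I ⊕ I → Y := Sum.elim (f · x) (g · x) with hc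
    let φ : (⊥ : SimpleGraph (I ⊕ I)) ↪g X := ⟨⟨c, hinj⟩, by
      intro s t
      simpa using hind s t⟩
    have hbot : P.Mem (⊥ : SimpleGraph (I ⊕ I)) :=
      P.mem_of_iso ⟨φ.isoInduceRange.symm⟩ (hP X hX _)
    have hφ := hμ X ⊥ hX hbot φ
    set p := μ (I ⊕ I) ⊥ hbot
    set ρ := μ Y X hX
    have hcard : (Fintype.card I : ℝ) = n := by rw [hI]
    let Z : VertexOrder (I ⊕ I) → ℝ := fun ω => ∑ t, discrepancy id (ω.Iic t) ^ 4
    -- Summing over all `2n` thresholds costs a factor `2n`; the result `O(n³)` is still `o(n⁴)`,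
    -- which a second moment would not achieve relative to `n²`.
    have hZ : p.expect Z ≤ 64 * (n : ℝ) ^ 3 := by
      have hp : ∀ e : Equiv.Perm (I ⊕ I), p.map (VertexOrder.induced e.toEmbedding) = p := by
        intro e
        rw [show p = _ from hμ.eq_uniform_of_bot hbot]
        exact VertexOrder.uniform_map_perm e
      calc p.expect Z = ∑ t, p.expect (fun ω => discrepancy id (ω.Iic t) ^ 4) :=
            p.expect_sum _ _
        _ ≤ ∑ t : I ⊕ I, 32 * (n : ℝ) ^ 2 := Finset.sum_le_sum fun t _ =>
            hcard ▸ VertexOrder.expect_discrepancy_le p hp t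
        _ = 64 * (n : ℝ) ^ 3 := by
            simp [hI]
            ring
    let D : VertexOrder Y → ℝ := fun ω =>
      ∑ i, ((if ω.induced (f i).toEmbedding = τ then 1 else 0) -
        (if ω.induced (g i).toEmbedding = τ then (1 : ℝ) else 0))
    have hl : 0 < ε * n := by positivity
    have hD : ∀ ω, |D ω| ≤ 2 * (ε * n) + 2 / (ε * n) ^ 3 * Z (ω.induced φ.toEmbedding) := by
      intro ω
      obtain ⟨H, L, hH, hL, hHL⟩ := VertexOrder.exists_count_sub_eq ω τ x b
        (fun i => (f i).toEmbedding) (fun i => (g i).toEmbedding) hfb hgb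
      let := ω.toLinearOrder
      -- `H` and `L` depend on `ω`; `Z` controls all lower sets at once.
      have lower : ∀ Q : Set Y, (∀ y z, ω.1 y z → z ∈ Q → y ∈ Q) →
          |discrepancy c Q| ≤ ε * n + Z (ω.induced φ.toEmbedding) / (ε * n) ^ 3 := by
        intro Q hQ
        refine abs_le_add_div_of_pow_le hl ((discrepancy_pow_le c (Q := Q) ?_).trans_eq ?_)
        · intro z y hyz hz
          rcases eq_or_lt_of_le hyz with rfl | hlt
          · exact hz
          · exact hQ y z hlt hz
        · refine Finset.sum_congr rfl fun t _ => ?_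
          congr 1
          refine discrepancy_congr fun s => ?_
          simp only [Set.mem_Iic, le_iff_lt_or_eq, hinj.eq_iff]
          change _ ↔ ω.1 (c s) (c t) ∨ s = t
          rfl
      have e : D ω = discrepancy c H - discrepancy c L := hHL
      rw [e]
      calc |discrepancy c H - discrepancy c L|
        _ ≤ |discrepancy c H| + |discrepancy c L| := abs_sub _ _
        _ ≤ _ := add_le_add (lower H hH) (lower L hL)
        _ = _ := by ring
    have hED : ρ.expect D = n * d := by
      have e₁ : ∀ i, ρ.expect (fun ω => if ω.induced (f i).toEmbedding = τ then 1 else 0) =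
          (μ V F hF τ).toReal := by
        intro i
        rw [← hμ X F hX hF (f i), ← PMF.expect_indicator, PMF.expect_map]
      have e₂ : ∀ i, ρ.expect (fun ω => if ω.induced (g i).toEmbedding = τ then 1 else 0) =
          (μ V F' hF' τ).toReal := by
        intro i
        rw [← hμ X F' hX hF' (g i), ← PMF.expect_indicator, PMF.expect_map]
      simp only [D]
      rw [PMF.expect_sum]
      simp only [PMF.expect_sub, e₁, e₂]
      simp [hI, hd]
      ring
    have hu : ρ.expect (fun ω => 2 * (ε * n) + 2 / (ε * n) ^ 3 * Z (ω.induced φ.toEmbedding)) ≤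
        2 * (ε * n) + 2 / (ε * n) ^ 3 * (64 * (n : ℝ) ^ 3) := by
      rw [PMF.expect_add, PMF.expect_const, PMF.expect_mul_left, ← PMF.expect_map ρ _ Z, hφ]
      gcongr
    have habs : |(n : ℝ) * d| ≤ 2 * (ε * n) + 2 / (ε * n) ^ 3 * (64 * (n : ℝ) ^ 3) := by
      rw [← hED, abs_le]
      constructor
      · rw [neg_le, ← PMF.expect_neg]
        exact (ρ.expect_mono fun ω => (neg_le_abs _).trans (hD ω)).trans hu
      · exact (ρ.expect_mono fun ω => (le_abs_self _).trans (hD ω)).trans hu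
    have hn' : (0 : ℝ) < n := by exact_mod_cast hn
    rw [abs_mul, Nat.abs_cast] at habs
    refine le_of_mul_le_mul_left (habs.trans_eq ?_) hn'
    field_simp
  by_contra hne
  have hpos : 0 < |d| := abs_pos.2 (sub_ne_zero.2 hne)
  -- With `ε = |d| / 8` and this `n`, both terms of the bound are at most `|d| / 8`, giving `|d| <
  -- |d| / 2`.
  obtain ⟨n, hn⟩ := exists_nat_gt (64 / ((|d| / 8) ^ 3 * (|d| / 8)))
  have hn0 : (0 : ℝ) < n := lt_trans (by positivity) hn
  have := bound n (by exact_mod_cast hn0) (|d| / 8) (by positivity)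
  have h1 : 64 / ((|d| / 8) ^ 3 * n) < |d| / 8 := by
    rw [div_lt_iff₀ (by positivity)] at hn ⊢
    linarith
  linarith

/-! ### The degree potential -/

namespace SimpleGraph

variable {V : Type u} [Finite V]

/-- A potential that decreases when edges are deleted, and when an edge is moved from a vertex to
another one of at least the same degree. -/
noncomputable def potential (G : SimpleGraph V) : ℕ :=
  letI := Fintype.ofFinite V
  ∑ v, (G.neighborSet v).ncard * (2 * Nat.card V - (G.neighborSet v).ncard)

theorem ncard_neighborSet_lt (G : SimpleGraph V) (v : V) :
    (G.neighborSet v).ncard < Nat.card V := by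
  rw [← Set.ncard_univ]
  exact Set.ncard_lt_ncard (Set.ssubset_univ_iff.2 fun h =>
    G.irrefl (v := v) (by rw [← mem_neighborSet, h]; trivial))

theorem potential_lt_of_lt {G H : SimpleGraph V} (h : G < H) : G.potential < H.potential := by
  classical
  let := Fintype.ofFinite V
  have hle : ∀ v, (G.neighborSet v).ncard ≤ (H.neighborSet v).ncard := fun v =>
    Set.ncard_le_ncard fun w hw => h.le hw
  -- `t (2n - t)` increases for `t ≤ n`, and all degrees are below `n`.
  have mono : ∀ n a b : ℕ, b < n → a ≤ b → a * (2 * n - a) ≤ b * (2 * n - b) := by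
    intro n a b hb hab
    obtain ⟨c, rfl⟩ := Nat.exists_eq_add_of_le hab
    obtain ⟨d, hd⟩ : ∃ d, 2 * n = a + c + a + c + d := ⟨2 * n - (a + c + a + c), by omega⟩
    have h1 : 2 * n - a = a + c + c + d := by omega
    have h2 : 2 * n - (a + c) = a + c + d := by omega
    rw [h1, h2]
    nlinarith
  have smono : ∀ n a b : ℕ, b < n → a < b → a * (2 * n - a) < b * (2 * n - b) := by
    intro n a b hb hab
    obtain ⟨c, rfl⟩ := Nat.exists_eq_add_of_le hab.le
    obtain ⟨d, hd⟩ : ∃ d, 2 * n = a + c + a + c + d := ⟨2 * n - (a + c + a + c), by omega⟩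
    have h1 : 2 * n - a = a + c + c + d := by omega
    have h2 : 2 * n - (a + c) = a + c + d := by omega
    have hc : 0 < c := by omega
    have hd' : 0 < d := by omega
    rw [h1, h2]
    nlinarith [mul_pos hc hd', mul_pos hc hc]
  refine Finset.sum_lt_sum (fun v _ => mono _ _ _ (H.ncard_neighborSet_lt v) (hle v)) ?_
  obtain ⟨a, b, hab, hab'⟩ : ∃ a b, H.Adj a b ∧ ¬ G.Adj a b := by
    by_contra! hcon
    exact h.not_ge fun a b => hcon a b
  refine ⟨a, Finset.mem_univ _, smono _ _ _ (H.ncard_neighborSet_lt a) ?_⟩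
  exact Set.ncard_lt_ncard ⟨fun w hw => h.le hw, fun hh => hab' (hh hab)⟩

omit [Finite V] in
theorem IsLeafVertex.eq_of_adj {G : SimpleGraph V} {x y z : V} (h : G.IsLeafVertex x)
    (hy : G.Adj x y) (hz : G.Adj x z) : z = y := by
  obtain ⟨w, hw⟩ := Set.ncard_eq_one.1 h
  have h1 : y ∈ ({w} : Set V) := hw ▸ hy
  have h2 : z ∈ ({w} : Set V) := hw ▸ hz
  rw [Set.mem_singleton_iff] at h1 h2
  rw [h1, h2]

open Classical in
/-- Moving a leaf `u₁` from `v₁` to the neighbour `v₂` of a leaf `u₂` decreases the potential if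
the degree of `v₂` is at least that of `v₁`. -/
theorem potential_comap_update_lt {G : SimpleGraph V} {u₁ u₂ v₁ v₂ : V}
    (h₁ : G.IsLeafVertex u₁) (h₂ : G.IsLeafVertex u₂) (a₁ : G.Adj u₁ v₁) (a₂ : G.Adj u₂ v₂)
    (hv : v₁ ≠ v₂) (hu : ¬ G.Adj u₁ u₂)
    (hd : (G.neighborSet v₁).ncard ≤ (G.neighborSet v₂).ncard) :
    (G.comap (Function.update id u₁ u₂)).potential < G.potential := by
  let := Fintype.ofFinite V
  set H := G.comap (Function.update id u₁ u₂) with hH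
  have hv₁ : v₁ ≠ u₁ := a₁.ne'
  have hv₂ : v₂ ≠ u₁ := fun h => hu (h ▸ a₂.symm)
  have hN₁ : ∀ x, G.Adj u₁ x ↔ x = v₁ := fun x => ⟨h₁.eq_of_adj a₁, fun h => h ▸ a₁⟩
  have hN₂ : ∀ x, G.Adj u₂ x ↔ x = v₂ := fun x => ⟨h₂.eq_of_adj a₂, fun h => h ▸ a₂⟩
  have hadj : ∀ x y, x ≠ u₁ → y ≠ u₁ → (H.Adj x y ↔ G.Adj x y) := by
    intro x y hx hy
    simp [hH, Function.update_of_ne hx, Function.update_of_ne hy]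
  have hadj₁ : ∀ x, H.Adj x u₁ ↔ x = v₂ := by
    intro x
    by_cases hx : x = u₁
    · subst hx
      simp [hv₂.symm]
    · simp [hH, Function.update_of_ne hx, G.adj_comm x, hN₂]
  have e₁ : H.neighborSet v₁ = G.neighborSet v₁ \ {u₁} := by
    ext x
    by_cases hx : x = u₁
    · subst hx
      simp [hadj₁, hv]
    · simp [hadj _ _ hv₁ hx, hx]
  have e₂ : H.neighborSet v₂ = insert u₁ (G.neighborSet v₂) := by
    ext x
    by_cases hx : x = u₁
    · subst hx
      simp [hadj₁]
    · simp [hadj _ _ hv₂ hx, hx]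
  have n₁ : (H.neighborSet v₁).ncard + 1 = (G.neighborSet v₁).ncard := by
    rw [e₁]
    exact Set.ncard_sdiff_singleton_add_one (show G.Adj v₁ u₁ from a₁.symm)
  have n₂ : (H.neighborSet v₂).ncard = (G.neighborSet v₂).ncard + 1 := by
    rw [e₂]
    refine Set.ncard_insert_of_notMem fun h => hv ?_
    exact ((hN₁ v₂).1 (G.adj_symm h)).symm
  have n₃ : ∀ x, x ≠ v₁ → x ≠ v₂ → (H.neighborSet x).ncard = (G.neighborSet x).ncard := by
    intro x hx hx'
    by_cases hxu : x = u₁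
    · subst hxu
      rw [show (G.neighborSet x).ncard = 1 from h₁, Set.ncard_eq_one]
      refine ⟨v₂, Set.ext fun y => ?_⟩
      rw [mem_neighborSet, H.adj_comm, hadj₁]
      rfl
    · congr 1
      ext y
      by_cases hy : y = u₁
      · subst hy
        simp only [mem_neighborSet, hadj₁, hx', false_iff]
        rw [G.adj_comm, hN₁]
        exact hx
      · simp [hadj _ _ hxu hy]
  have hlt := H.ncard_neighborSet_lt v₂
  unfold potential
  have hmem : v₂ ∈ Finset.univ.erase v₁ := by simp [hv.symm]
  rw [← Finset.add_sum_erase _ _ (Finset.mem_univ v₁), ← Finset.add_sum_erase _ _ hmem,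
    ← Finset.add_sum_erase (a := v₁) Finset.univ _ (Finset.mem_univ v₁),
    ← Finset.add_sum_erase _ _ hmem, ← add_assoc, ← add_assoc]
  refine add_lt_add_of_lt_of_le ?_ (le_of_eq <| Finset.sum_congr rfl fun x hx => ?_)
  · have arith : ∀ n a b : ℕ, b + 1 < n → a + 1 ≤ b →
        a * (2 * n - a) + (b + 1) * (2 * n - (b + 1)) <
          (a + 1) * (2 * n - (a + 1)) + b * (2 * n - b) := by
      intro n a b hb hab
      obtain ⟨c, rfl⟩ := Nat.exists_eq_add_of_le hab
      obtain ⟨d, hd⟩ : ∃ d, 2 * n = a + 1 + c + 1 + d := ⟨2 * n - (a + 1 + c + 1), by omega⟩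
      have h1 : 2 * n - a = 1 + c + 1 + d := by omega
      have h2 : 2 * n - (a + 1) = c + 1 + d := by omega
      have h3 : 2 * n - (a + 1 + c + 1) = d := by omega
      have h4 : 2 * n - (a + 1 + c) = 1 + d := by omega
      rw [h1, h2, h3, h4]
      nlinarith
    rw [n₂] at hlt ⊢
    rw [← n₁] at hd ⊢
    exact arith _ _ _ hlt hd
  · simp only [Finset.mem_erase] at hx
    rw [n₃ x hx.2.1 hx.1]

omit [Finite V] in
/-- Blowing up the two ends of an edge creates a cycle. -/
theorem not_isAcyclic_blowUp {G : SimpleGraph V} {x y : V} (h : G.Adj x y) {m : V → ℕ}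
    (hx : 2 ≤ m x) (hy : 2 ≤ m y) : ¬ (G.blowUp m).IsAcyclic := by
  intro hac
  let a : Fin (m x) → Σ v, Fin (m v) := fun i => ⟨x, i⟩
  let b : Fin (m y) → Σ v, Fin (m v) := fun i => ⟨y, i⟩
  have hab : ∀ i j, (G.blowUp m).Adj (a i) (b j) := fun i j => h
  have hne : ∀ i j, a i ≠ b j := fun i j => (hab i j).ne
  have ha : a ⟨0, by omega⟩ ≠ a ⟨1, by omega⟩ := by simp [a]
  have hb : b ⟨0, by omega⟩ ≠ b ⟨1, by omega⟩ := by simp [b]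
  -- Two copies of `y` give two different paths between the same copies of `x`.
  let p (j : Fin (m y)) : (G.blowUp m).Walk (a ⟨0, by omega⟩) (a ⟨1, by omega⟩) :=
    .cons (hab _ j) (.cons (hab _ j).symm .nil)
  have hp : ∀ j, (p j).IsPath := fun j => by
    simp [p, Walk.isPath_def, hne, ha, (hne _ _).symm]
  have := congrArg (fun q : (G.blowUp m).Path _ _ => q.1.support)
    ((hac.subsingleton_path _ _).elim ⟨p ⟨0, by omega⟩, hp _⟩ ⟨p ⟨1, by omega⟩, hp _⟩)
  simp [p, hb] at this

end SimpleGraph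

/-! ### The two leaf moves -/

theorem GraphProperty.IsHereditary.mem_of_embedding {P : GraphProperty.{u}} (hP : P.IsHereditary)
    {V W : Type u} [Finite V] [Finite W] {G : SimpleGraph V} {H : SimpleGraph W} (f : H ↪g G)
    (hG : P.Mem G) : P.Mem H :=
  P.mem_of_iso ⟨f.isoInduceRange.symm⟩ (hP G hG (Set.range f))

namespace SimpleGraph

/-- The embedding of a graph into its blow-up that picks one copy of each vertex. -/
def blowUpEmbedding {V : Type u} (G : SimpleGraph V) {m : V → ℕ} (j : ∀ v, Fin (m v)) :
    G ↪g G.blowUp m where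
  toFun v := ⟨v, j v⟩
  inj' _ _ h := congrArg Sigma.fst h
  map_rel_iff' := Iff.rfl

end SimpleGraph

open Classical in
/-- If the vertex `u` of `F` can be replaced by twins and isolated vertices can be added, then
the random ordering does not change when `u` is isolated. -/
theorem OrderingModel.IsConsistent.eq_deleteIncidenceSet {P : GraphProperty.{u}}
    {μ : OrderingModel P} (hμ : μ.IsConsistent) (hP : P.IsHereditary) {V : Type u} [Finite V]
    {F : SimpleGraph V} (hF : P.Mem F) (u : V)
    (h : ∀ m : V → ℕ, (∀ v, v ≠ u → m v = 1) →
      ∀ k : ℕ, P.Mem (F.blowUp m ⊕g (⊥ : SimpleGraph (Fin k)))) :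
    ∃ hF' : P.Mem (F.deleteIncidenceSet u), μ V F hF = μ V (F.deleteIncidenceSet u) hF' := by
  let m (n : ℕ) (v : V) : ℕ := if v = u then n else 1
  let j (n : ℕ) (i : Fin n) (v : V) : Fin (m n v) :=
    ⟨if v = u then i else 0, by dsimp only [m]; split_ifs <;> simp⟩
  have hm (n : ℕ) : P.Mem (F.blowUp (m n) ⊕g (⊥ : SimpleGraph (Fin n))) :=
    h _ (fun v hv => if_neg hv) n
  let f (n : ℕ) (i : ULift.{u} (Fin n)) : F ↪g F.blowUp (m n) ⊕g (⊥ : SimpleGraph (Fin n)) :=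
    SimpleGraph.Embedding.sumInl.comp (F.blowUpEmbedding (j n i.down))
  -- A copy of the modified graph uses the `i`-th added isolated vertex in place of `u`.
  let b (n : ℕ) (i : ULift.{u} (Fin n)) (v : V) : (Σ v, Fin (m n v)) ⊕ Fin n :=
    if v = u then .inr i.down else f n i v
  have hb : ∀ n i i' v, v ≠ u → b n i v = f n i' v := by
    intro n i i' v hv
    have hj : j n i.down v = j n i'.down v := Fin.ext (by simp [j, hv])
    exact (if_neg hv).trans (congrArg (Sum.inl ∘ Sigma.mk v) hj)
  let g (n : ℕ) (i : ULift.{u} (Fin n)) :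
      F.deleteIncidenceSet u ↪g F.blowUp (m n) ⊕g (⊥ : SimpleGraph (Fin n)) :=
    { toFun := b n i
      inj' := by
        intro v w hvw
        by_cases hv : v = u <;> by_cases hw : w = u
        · rw [hv, hw]
        · simp [b, hv, hw, f] at hvw
        · simp [b, hv, hw, f] at hvw
        · simp only [b, hv, hw, if_false] at hvw
          exact (f n i).injective hvw
      map_rel_iff' := by
        intro v w
        change (F.blowUp (m n) ⊕g (⊥ : SimpleGraph (Fin n))).Adj (b n i v) (b n i w) ↔ _
        rw [SimpleGraph.deleteIncidenceSet_adj]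
        by_cases hv : v = u <;> by_cases hw : w = u
        · simp [b, hv, hw]
        · simp [b, hv, hw, f]
        · simp [b, hv, hw, f]
        · simp only [b, hv, hw, if_false, (f n i).map_adj_iff]
          exact ⟨fun h => ⟨h, hv, hw⟩, fun h => h.1⟩ }
  have hF' : P.Mem (F.deleteIncidenceSet u) := hP.mem_of_embedding (g 1 ⟨0⟩) (hm 1)
  refine ⟨hF', hμ.eq_of_embeddings hP hF hF' u fun n hn => ?_⟩
  have hg : ∀ i, g n i u = .inr i.down := fun i => if_pos rfl
  refine ⟨ULift.{u} (Fin n), _, inferInstance, inferInstance, _, hm n, f n ⟨0, hn⟩, f n, g n,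
    by simp, fun i w hw => (hb n i i w hw).symm.trans (hb n i _ w hw), fun i w hw => hb n i _ w hw,
    ?_, ?_⟩
  · refine Function.Injective.sumElim ?_ ?_ fun i i' h =>
      Sum.inl_ne_inr (h.trans (hg i'))
    · intro i i' hii
      have hj : j n i.down u = j n i'.down u :=
        eq_of_heq (Sigma.ext_iff.1 (Sum.inl_injective hii)).2
      simpa [j, ← Fin.ext_iff] using hj
    · intro i i' hii
      simpa [hg] using hii
  · rintro (i | i) (i' | i') <;> simp only [Sum.elim_inl, Sum.elim_inr, hg]
    · exact F.irrefl
    · change ¬ (F.blowUp (m n) ⊕g ⊥).Adj (.inl ⟨u, j n i.down u⟩) (.inr i'.down)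
      simp
    · change ¬ (F.blowUp (m n) ⊕g ⊥).Adj (.inr i.down) (.inl ⟨u, j n i'.down u⟩)
      simp
    · simp

open Classical in
/-- If the nonadjacent vertices `u₁` and `u₂` of `F` can be replaced by twins, then the random
ordering does not change when `u₁` is turned into a twin of `u₂`. -/
theorem OrderingModel.IsConsistent.eq_comap_update {P : GraphProperty.{u}}
    {μ : OrderingModel P} (hμ : μ.IsConsistent) (hP : P.IsHereditary) {V : Type u} [Finite V]
    {F : SimpleGraph V} (hF : P.Mem F) {u₁ u₂ : V} (hne : u₁ ≠ u₂) (hadj : ¬ F.Adj u₁ u₂)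
    (h : ∀ m : V → ℕ, (∀ v, v ≠ u₁ → v ≠ u₂ → m v = 1) → P.Mem (F.blowUp m)) :
    ∃ hF' : P.Mem (F.comap (Function.update id u₁ u₂)),
      μ V F hF = μ V (F.comap (Function.update id u₁ u₂)) hF' := by
  -- Copy 0 of `u₂` plays `u₂` itself; the other `n` copies, indexed by `i + 1`, play the moved
  -- `u₁`.
  let m (n : ℕ) (v : V) : ℕ := if v = u₁ then n else if v = u₂ then n + 1 else 1
  let j (n : ℕ) (i : Fin n) (v : V) : Fin (m n v) :=
    ⟨if v = u₁ then i else 0, by dsimp only [m]; split_ifs <;> simp⟩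
  have hm (n : ℕ) : P.Mem (F.blowUp (m n)) :=
    h _ fun v hv hv' => by simp only [m, if_neg hv, if_neg hv']
  let f (n : ℕ) (i : ULift.{u} (Fin n)) : F ↪g F.blowUp (m n) := F.blowUpEmbedding (j n i.down)
  let k (n : ℕ) (i : Fin n) : Fin (m n u₂) := ⟨i + 1, by simp [m, hne.symm]⟩
  let b (n : ℕ) (i : ULift.{u} (Fin n)) (v : V) : Σ v, Fin (m n v) :=
    if v = u₁ then ⟨u₂, k n i.down⟩ else f n i v
  have hb : ∀ n i i' v, v ≠ u₁ → b n i v = f n i' v := by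
    intro n i i' v hv
    have hj : j n i.down v = j n i'.down v := Fin.ext (by simp [j, hv])
    exact (if_neg hv).trans (congrArg (Sigma.mk v) hj)
  have hfst : ∀ n i v, (b n i v).1 = Function.update id u₁ u₂ v := by
    intro n i v
    by_cases hv : v = u₁
    · subst hv
      simp [b]
    · simp only [b, if_neg hv, Function.update_of_ne hv]
      rfl
  have hcross : ∀ n (i : ULift.{u} (Fin n)) v, v ≠ u₁ →
      (⟨u₂, k n i.down⟩ : Σ v, Fin (m n v)) ≠ f n i v := by
    intro n i v hv hh
    obtain rfl : u₂ = v := congrArg Sigma.fst hh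
    have hkj : k n i.down = j n i.down u₂ := eq_of_heq (Sigma.ext_iff.1 hh).2
    simp [k, j, hv] at hkj
  let g (n : ℕ) (i : ULift.{u} (Fin n)) :
      F.comap (Function.update id u₁ u₂) ↪g F.blowUp (m n) :=
    { toFun := b n i
      inj' := by
        intro v w hvw
        by_cases hv : v = u₁ <;> by_cases hw : w = u₁
        · rw [hv, hw]
        · simp only [b, hv, hw, if_true, if_false] at hvw
          exact absurd hvw (hcross n i w hw)
        · simp only [b, hv, hw, if_true, if_false] at hvw
          exact absurd hvw.symm (hcross n i v hv)
        · simp only [b, hv, hw, if_false] at hvw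
          exact (f n i).injective hvw
      map_rel_iff' := by
        intro v w
        change F.Adj (b n i v).1 (b n i w).1 ↔ _
        rw [hfst, hfst]
        rfl }
  have hF' : P.Mem (F.comap (Function.update id u₁ u₂)) := hP.mem_of_embedding (g 1 ⟨0⟩) (hm 1)
  refine ⟨hF', hμ.eq_of_embeddings hP hF hF' u₁ fun n hn => ?_⟩
  have hg : ∀ i, g n i u₁ = ⟨u₂, k n i.down⟩ := fun i => if_pos rfl
  refine ⟨ULift.{u} (Fin n), _, inferInstance, inferInstance, _, hm n, f n ⟨0, hn⟩, f n, g n,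
    by simp, fun i w hw => (hb n i i w hw).symm.trans (hb n i _ w hw), fun i w hw => hb n i _ w hw,
    ?_, ?_⟩
  · refine Function.Injective.sumElim ?_ ?_ fun i i' h =>
      hne (congrArg Sigma.fst (h.trans (hg i')))
    · intro i i' hii
      have hj : j n i.down u₁ = j n i'.down u₁ := eq_of_heq (Sigma.ext_iff.1 hii).2
      simpa [j, ← Fin.ext_iff] using hj
    · intro i i' hii
      simp only [hg] at hii
      have hk : k n i.down = k n i'.down := eq_of_heq (Sigma.ext_iff.1 hii).2
      simpa [k, ← Fin.ext_iff] using hk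
  · have hadj' : ¬ F.Adj u₂ u₁ := fun h => hadj h.symm
    rintro (i | i) (i' | i') <;> simp only [Sum.elim_inl, Sum.elim_inr, hg]
    exacts [F.irrefl, hadj, hadj', F.irrefl]

/-! ### Induction on the potential -/

theorem theorem1p5 (P : GraphProperty.{u}) (hP : P.IsHereditary)
    (hforest : ∀ {V : Type u} [Finite V] (F : SimpleGraph V), P.Mem F → F.IsAcyclic)
    (hleaves : ∀ {V : Type u} [Finite V] (F : SimpleGraph V), P.Mem F → F ≠ ⊥ →
      P.HasFreeLeaf F ∨ P.HasFreeLeafPair F) :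
    P.IsUniform := by
  classical
  refine fun μ => ⟨fun hμ => ?_, fun h => h ▸ OrderingModel.uniform_isConsistent P⟩
  funext V _ F hF
  change μ V F hF = PMF.uniformOfFintype (VertexOrder V)
  induction hΦ : F.potential using Nat.strong_induction_on generalizing F with
  | _ n ih =>
    subst hΦ
    by_cases hbot : F = ⊥
    · subst hbot
      exact hμ.eq_uniform_of_bot hF
    rcases hleaves F hF hbot with ⟨u, hu, hm⟩ | ⟨u₁, u₂, v₁, v₂, h₁, h₂, a₁, a₂, hv, hm⟩
    · obtain ⟨hF', heq⟩ := hμ.eq_deleteIncidenceSet hP hF u hm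
      obtain ⟨v, hv⟩ := Set.ncard_eq_one.1 hu
      have huv : F.Adj u v := by
        rw [← SimpleGraph.mem_neighborSet, hv]
        rfl
      refine heq.trans (ih _ (SimpleGraph.potential_lt_of_lt ?_) _ hF' rfl)
      refine lt_of_le_of_ne (F.deleteIncidenceSet_le u) fun h => ?_
      rw [← h, SimpleGraph.deleteIncidenceSet_adj] at huv
      exact huv.2.1 rfl
    · have hne : u₁ ≠ u₂ := by
        rintro rfl
        exact hv (h₁.eq_of_adj a₂ a₁)
      -- Doubling two adjacent leaves would create a 4-cycle within the property.
      have hadj : ¬ F.Adj u₁ u₂ := by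
        intro h
        let m (v : V) : ℕ := if v = u₁ ∨ v = u₂ then 2 else 1
        exact SimpleGraph.not_isAcyclic_blowUp (m := m) h (by simp [m]) (by simp [m])
          (hforest _ (hm m fun v hv hv' => by simp [m, hv, hv']))
      -- The hypothesis is symmetric in the two leaves, so the direction that lowers the potential
      -- may be chosen.
      rcases le_total (F.neighborSet v₁).ncard (F.neighborSet v₂).ncard with hd | hd
      · obtain ⟨hF', heq⟩ := hμ.eq_comap_update hP hF hne hadj hm
        exact heq.trans (ih _
          (SimpleGraph.potential_comap_update_lt h₁ h₂ a₁ a₂ hv hadj hd) _ hF' rfl)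
      · have hadj' : ¬ F.Adj u₂ u₁ := fun h => hadj h.symm
        obtain ⟨hF', heq⟩ := hμ.eq_comap_update hP hF hne.symm hadj' fun m hmv =>
          hm m fun v hv hv' => hmv v hv' hv
        exact heq.trans (ih _
          (SimpleGraph.potential_comap_update_lt h₂ h₁ a₂ a₁ hv.symm hadj' hd) _ hF' rfl)
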